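/- Let $G$ be a real Lie group and let $N,H$ be closed (Lie) subgroups of $G$ with Lie algebras $\mathfrak n,\mathfrak h$, where $N$ is normal, $G=NH$, $N\cap H=\{e\}$, $H$ is connected, and $N$ is exponential solvable ($\mathfrak n$ is solvable and $\exp:\mathfrak n\to N$ is a diffeomorphism, with inverse $\log$). Let $\mu$ be a left Haar measure on $H$. Let $\lambda\in\mathfrak n^*$ vanish on $[\mathfrak n,\mathfrak n]$, put $\beta_\lambda(h)=Ad(h^{-1})^*\lambda\in\mathfrak n^*$ for $h\in H$, and assume that $\beta_\lambda:H\to\mathfrak n^*$ is an immersion at the identity. Let $\pi$ be the representation of $G$ on $L^2(H,\mu)$ induced from the character $\exp Y\mapsto e^{2\pi i\langle\lambda,Y\rangle}$ of $N$, that is, $$[\pi(x)g](h)=e^{2\pi i\langle\beta_\lambda(h),\log x\rangle}g(h)\quad(x\in N),\qquad [\pi(z)g](h)=g(z^{-1}h)\quad(z\in H).$$ Fix a basis $X_1,\dots,X_n$ of $\mathfrak n$ and a subset $J\subseteq\{1,\dots,n\}$; let $\mathfrak p=\mathrm{span}\{X_j:j\in J\}$, let $P$ be the projection of $\mathfrak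 n$ onto $\mathfrak p$ along the span of the other $X_k$, and identify $\mathfrak p^*=P^*\mathfrak n^*$ with $\mathbb R^J$ through $\xi\mapsto(\langle\xi,X_j\rangle)_{j\in J}$, with Lebesgue measure $d\xi$; $|E|$ denotes the Lebesgue measure of $E\subseteq\mathfrak p^*$. Let $\varphi:\mathcal O\to\varphi(\mathcal O)\subseteq\mathfrak h$ be a smooth chart of $H$ with $\varphi(e)=0$, on a connected, relatively compact open neighbourhood $\mathcal O$ of $e$, such that $\Theta_\lambda=P^*\circ\beta_\lambda\circ\varphi^{-1}$ is a diffeomorphism of $\varphi(\mathcal O)$ onto a relatively compact open subset of $\mathfrak p^*$. Let $\mathbf W_\lambda$ be the Radon–Nikodym derivative with respect to $d\xi$ of the image of $\mu|_{\mathcal O}$ under $\Theta_\lambda\circ\varphi$, and let $\mathbf w(h)=\mathbf W_\lambda(\Theta_\lambda(\varphi(h)))$ for $h\in\mathcal O$. Let $C\subseteq\mathfrak p^*$ be compact with $\Theta_\lambda(\varphi(\mathcal O))\subseteq C$, and let $\Gamma_N\subseteq\exp(\mathfrak p)$ be a discrete set such that $\{|C|^{-1/2}e^{2\pi i\langle\xi,Y\rangle}:Y\in\log\Gamma_N\}$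 is an orthonormal basis of $L^2(C,d\xi)$. Let $f:H\to\mathbb C$ be continuous and vanish outside $\mathcal O$, and let $\Lambda\subseteq H$ be discrete. If the family $\{\pi(\gamma)f:\gamma\in\Lambda^{-1}\Gamma_N\}$ is a frame for $L^2(H,\mu)$ with frame bounds $0<A\le B$, i.e. $A\|g\|^2\le\sum_{\gamma\in\Lambda^{-1}\Gamma_N}|\langle g,\pi(\gamma)f\rangle|^2\le B\|g\|^2$ for all $g\in L^2(H,\mu)$, then for $\mu$-almost every $h\in H$ $$A|C|^{-1}\le\sum_{\ell\in\Lambda}\bigl|f(\ell h)\sqrt{\mathbf w(\ell h)}\bigr|^2\le B|C|^{-1},$$ where terms with $\ell h\notin\mathcal O$ are $0$. In particular, $f$ is bounded. -/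

import Mathlib

open scoped Manifold ContDiff Topology Pointwise
open MeasureTheory

noncomputable section

namespace LocalizedFrames

/-! ### Frames -/

section Frame

variable {ι 𝓗 : Type*} [NormedAddCommGroup 𝓗] [InnerProductSpace ℂ 𝓗]

/-- The family `v` is a frame for the Hilbert space `𝓗`, with frame bounds `0 < A ≤ B`:
`A ‖g‖² ≤ ∑ i, |⟨g, v i⟩|² ≤ B ‖g‖²` for all `g`. -/
structure IsFrame (v : ι → 𝓗) (A B : ℝ) : Prop where
  pos : 0 < A
  le : A ≤ B
  summable : ∀ g : 𝓗, Summable fun i => ‖inner ℂ (v i) g‖ ^ 2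
  lower : ∀ g : 𝓗, A * ‖g‖ ^ 2 ≤ ∑' i, ‖inner ℂ (v i) g‖ ^ 2
  upper : ∀ g : 𝓗, ∑' i, ‖inner ℂ (v i) g‖ ^ 2 ≤ B * ‖g‖ ^ 2

end Frame

/-! ### Lie groups and their exponential map -/

section Exponential

variable {E K : Type*} [NormedAddCommGroup E] [NormedSpace ℝ E]
  [TopologicalSpace K] [ChartedSpace E K] [Group K]

/-- `γ` is the one-parameter subgroup of `K` with velocity `X` at the identity. -/
structure IsOneParameterSubgroup (γ : ℝ → K) (X : GroupLieAlgebra 𝓘(ℝ, E) K) : Prop where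
  contMDiff : ContMDiff 𝓘(ℝ, ℝ) 𝓘(ℝ, E) ∞ γ
  map_add : ∀ s t, γ (s + t) = γ s * γ t
  velocity : (mfderiv 𝓘(ℝ, ℝ) 𝓘(ℝ, E) γ 0 (1 : ℝ) : E) = X

open Classical in
/-- The exponential map of a Lie group: `exp X = γ 1`, where `γ` is the one-parameter subgroup
with velocity `X` at the identity. -/
def lieExp (X : GroupLieAlgebra 𝓘(ℝ, E) K) : K :=
  if h : ∃ γ : ℝ → K, IsOneParameterSubgroup γ X then h.choose 1 else 1

/-- The logarithm: the inverse of the exponential map (used when `exp` is a bijection). -/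
def lieLog (x : K) : GroupLieAlgebra 𝓘(ℝ, E) K :=
  Function.invFun (lieExp (E := E) (K := K)) x

theorem lieGroup_minSmoothness [LieGroup 𝓘(ℝ, E) ∞ K] :
    LieGroup 𝓘(ℝ, E) (minSmoothness ℝ 3) K := by
  rw [minSmoothness_of_isRCLikeNormedField]
  exact LieGroup.of_le (n := ∞) ENat.LEInfty.out

variable (E K) in
/-- `K` is an exponential solvable Lie group: its Lie algebra is solvable, and its exponential map
is a diffeomorphism of the Lie algebra (which is `E` as a vector space) onto `K`. -/
structure IsExponentialSolvable [FiniteDimensional ℝ E] [LieGroup 𝓘(ℝ, E) ∞ K] : Prop where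
  solvable :
    haveI := FiniteDimensional.complete ℝ E
    haveI := lieGroup_minSmoothness (E := E) (K := K)
    LieAlgebra.IsSolvable (GroupLieAlgebra 𝓘(ℝ, E) K)
  exp_diffeomorph :
    ∃ e : Diffeomorph 𝓘(ℝ, E) 𝓘(ℝ, E) E K ∞, ∀ X : E, e X = lieExp (E := E) (K := K) X

end Exponential

/-! ### The group `G = NH`, the adjoint action, and the induced representation -/

section Setting

open Manifold

variable {EG EN EH G : Type*}
  [NormedAddCommGroup EG] [NormedSpace ℝ EG] [NormedAddCommGroup EN] [NormedSpace ℝ EN]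
  [NormedAddCommGroup EH] [NormedSpace ℝ EH]
  [TopologicalSpace G] [ChartedSpace EG G] [Group G]

variable (EG EN EH) in
/-- `N` and `H` are closed (embedded) Lie subgroups of `G` such that every element of `G` is
uniquely a product of an element of `N` and an element of `H`. -/
structure IsLieFactorization (N H : Subgroup G) [ChartedSpace EN N] [ChartedSpace EH H] :
    Prop where
  closed_left : IsClosed (N : Set G)
  closed_right : IsClosed (H : Set G)
  embedding_left : IsSmoothEmbedding 𝓘(ℝ, EN) 𝓘(ℝ, EG) ∞ (Subtype.val : N → G)
  embedding_right : IsSmoothEmbedding 𝓘(ℝ, EH) 𝓘(ℝ, EG) ∞ (Subtype.val : H → G)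
  isComplement : N.IsComplement' H

variable {N H : Subgroup G} [N.Normal] [ChartedSpace EN N] [ChartedSpace EH H]

/-- The adjoint action on the Lie algebra `𝔫` of the normal subgroup `N`: `Ad s` is the
differential at the identity of `y ↦ s * y * s⁻¹`. -/
def Ad (s : G) : GroupLieAlgebra 𝓘(ℝ, EN) N →L[ℝ] GroupLieAlgebra 𝓘(ℝ, EN) N :=
  (mfderiv 𝓘(ℝ, EN) 𝓘(ℝ, EN) (fun y : N => MulAut.conjNormal s y) 1 : EN →L[ℝ] EN)

/-- `β_lam h = Ad(h⁻¹)^* lam`, a linear functional on `𝔫`: its value at `X` is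
`lam (Ad(h⁻¹) X)`. -/
def beta (lam : Module.Dual ℝ (GroupLieAlgebra 𝓘(ℝ, EN) N)) (h : H) :
    Module.Dual ℝ (GroupLieAlgebra 𝓘(ℝ, EN) N) :=
  lam ∘ₗ (Ad (EN := EN) (N := N) ((h : G)⁻¹)).toLinearMap

theorem contMDiff_conj [FiniteDimensional ℝ EG] [LieGroup 𝓘(ℝ, EG) ∞ G]
    (hG : IsLieFactorization EG EN EH N H) :
    ContMDiff (𝓘(ℝ, EH).prod 𝓘(ℝ, EN)) 𝓘(ℝ, EN) ∞
      (fun p : H × N => (MulAut.conjNormal ((p.1 : G)⁻¹) p.2 : N)) := by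
  have := topologicalGroup_of_lieGroup 𝓘(ℝ, EG) ∞ (G := G)
  have hH : ContMDiff (𝓘(ℝ, EH).prod 𝓘(ℝ, EN)) 𝓘(ℝ, EG) ∞ (fun p : H × N => (p.1 : G)) :=
    hG.embedding_right.contMDiff.comp contMDiff_fst
  have hN : ContMDiff (𝓘(ℝ, EH).prod 𝓘(ℝ, EN)) 𝓘(ℝ, EG) ∞ (fun p : H × N => (p.2 : G)) :=
    hG.embedding_left.contMDiff.comp contMDiff_snd
  have key : ContMDiff (𝓘(ℝ, EH).prod 𝓘(ℝ, EN)) 𝓘(ℝ, EG) ∞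
      (fun p : H × N => (p.1 : G)⁻¹ * (p.2 : G) * ((p.1 : G)⁻¹)⁻¹) :=
    (hH.inv.mul hN).mul hH.inv.inv
  rw [ContMDiff.iff_comp_isImmersion hG.embedding_left.isImmersion]
  refine ⟨?_, key⟩
  rw [hG.embedding_left.isEmbedding.continuous_iff]
  exact key.continuous

theorem continuous_beta [FiniteDimensional ℝ EG] [FiniteDimensional ℝ EN]
    [LieGroup 𝓘(ℝ, EG) ∞ G] [LieGroup 𝓘(ℝ, EN) ∞ N] [LieGroup 𝓘(ℝ, EH) ∞ H]
    (hG : IsLieFactorization EG EN EH N H)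
    (lam : Module.Dual ℝ (GroupLieAlgebra 𝓘(ℝ, EN) N)) (X : GroupLieAlgebra 𝓘(ℝ, EN) N) :
    Continuous (fun h : H => beta lam h X) := by
  have : IsManifold 𝓘(ℝ, EN) 1 N := IsManifold.of_le (n := ∞) (by exact_mod_cast le_top)
  have : IsManifold 𝓘(ℝ, EH) 1 H := IsManifold.of_le (n := ∞) (by exact_mod_cast le_top)
  have hAd : Continuous (fun h : H => (Ad (EN := EN) (N := N) ((h : G)⁻¹) : EN →L[ℝ] EN)) := by
    rw [continuous_iff_continuousAt]
    intro h₀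
    have h1 := ContMDiffAt.mfderiv (I := 𝓘(ℝ, EN)) (I' := 𝓘(ℝ, EN)) (J := 𝓘(ℝ, EH))
      (n := ∞) (m := 0) (x₀ := h₀)
      (fun (h : H) (y : N) => (MulAut.conjNormal ((h : G)⁻¹) y : N)) (fun _ => (1 : N))
      ((contMDiff_conj hG).contMDiffAt) contMDiffAt_const (by simp)
    have gen : ∀ (g : H → N), (∀ h, g h = 1) → ∀ (Φ : H → EN →L[ℝ] EN) (h : H),
        inTangentCoordinates 𝓘(ℝ, EN) 𝓘(ℝ, EN) (fun _ : H => (1 : N)) g Φ h₀ h = Φ h := by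
      intro g hg Φ h
      obtain rfl : g = fun _ => 1 := funext hg
      rw [inTangentCoordinates_eq (x₀ := h₀) (x := h) _ _ _ (mem_chart_source EN (1 : N))
        (mem_chart_source EN (1 : N))]
      ext v
      simp only [ContinuousLinearMap.comp_apply]
      rw [(tangentBundleCore 𝓘(ℝ, EN) N).coordChange_self _ _ (mem_chart_source _ _),
        (tangentBundleCore 𝓘(ℝ, EN) N).coordChange_self _ _ (mem_chart_source _ _)]
    exact h1.continuousAt.congr (Filter.Eventually.of_forall fun h =>
      gen _ (fun h => map_one _) _ h)
  let lam' : EN →ₗ[ℝ] ℝ := lam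
  have hlam : Continuous lam' := LinearMap.continuous_of_finiteDimensional lam'
  let X' : EN := X
  let a : H → EN →L[ℝ] EN := fun h => Ad (EN := EN) (N := N) ((h : G)⁻¹)
  have ha : Continuous a := hAd
  have hX : Continuous (fun h : H => a h X') := ha.clm_apply continuous_const
  exact hlam.comp hX

variable [MeasurableSpace H] [BorelSpace H]

theorem memLp_modulation [FiniteDimensional ℝ EG] [FiniteDimensional ℝ EN]
    [LieGroup 𝓘(ℝ, EG) ∞ G] [LieGroup 𝓘(ℝ, EN) ∞ N] [LieGroup 𝓘(ℝ, EH) ∞ H]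
    (hG : IsLieFactorization EG EN EH N H)
    (lam : Module.Dual ℝ (GroupLieAlgebra 𝓘(ℝ, EN) N)) (μ : Measure H)
    (Y : GroupLieAlgebra 𝓘(ℝ, EN) N) (F : Lp ℂ 2 μ) :
    MemLp (fun h : H => Complex.exp (2 * Real.pi * Complex.I * (beta lam h Y : ℝ)) * F h) 2 μ := by
  have hc : Continuous
      (fun h : H => Complex.exp (2 * Real.pi * Complex.I * (beta lam h Y : ℝ))) :=
    Complex.continuous_exp.comp
      (continuous_const.mul (Complex.continuous_ofReal.comp (continuous_beta hG lam Y)))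
  refine (Lp.memLp F).of_le (hc.aestronglyMeasurable.mul (Lp.aestronglyMeasurable F))
    (Filter.Eventually.of_forall fun h => ?_)
  have h1 : (2 * Real.pi * Complex.I * (beta lam h Y : ℝ) : ℂ)
      = ((2 * Real.pi * beta lam h Y : ℝ) : ℂ) * Complex.I := by
    push_cast
    ring
  rw [norm_mul, h1, Complex.norm_exp_ofReal_mul_I, one_mul]

/-- The operator `π(exp Y)` on `L²(H, μ)`, for `Y ∈ 𝔫`:
`[π(exp Y) F](h) = exp(2πi ⟨Ad(h⁻¹)^* lam, Y⟩) F(h)`. -/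
def modulation [FiniteDimensional ℝ EG] [FiniteDimensional ℝ EN]
    [LieGroup 𝓘(ℝ, EG) ∞ G] [LieGroup 𝓘(ℝ, EN) ∞ N] [LieGroup 𝓘(ℝ, EH) ∞ H]
    (hG : IsLieFactorization EG EN EH N H)
    (lam : Module.Dual ℝ (GroupLieAlgebra 𝓘(ℝ, EN) N)) (μ : Measure H)
    (Y : GroupLieAlgebra 𝓘(ℝ, EN) N) (F : Lp ℂ 2 μ) : Lp ℂ 2 μ :=
  (memLp_modulation hG lam μ Y F).toLp _

theorem measurePreserving_left [LieGroup 𝓘(ℝ, EH) ∞ H] (μ : Measure H) [μ.IsHaarMeasure] (z : H) :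
    MeasurePreserving (fun h : H => z⁻¹ * h) μ μ := by
  have := topologicalGroup_of_lieGroup 𝓘(ℝ, EH) ∞ (G := H)
  exact measurePreserving_mul_left μ z⁻¹

/-- The operator `π(z)` on `L²(H, μ)`, for `z ∈ H`: `[π(z) F](h) = F(z⁻¹ h)`. -/
def translation [LieGroup 𝓘(ℝ, EH) ∞ H] (μ : Measure H) [μ.IsHaarMeasure] (z : H)
    (F : Lp ℂ 2 μ) : Lp ℂ 2 μ :=
  Lp.compMeasurePreserving (fun h : H => z⁻¹ * h) (measurePreserving_left (EH := EH) μ z) F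

/-- The representation `π` of `G = NH` induced by the character `exp Y ↦ exp(2πi ⟨lam, Y⟩)` of
`N`, realized on `L²(H, μ)`: `π(z x) = π(z) π(x)` for `z ∈ H` and `x ∈ N`, where `π(z)` is left
translation by `z` and `π(x)` is multiplication by `exp(2πi ⟨Ad(h⁻¹)^* lam, log x⟩)`.
Every `g ∈ G` is uniquely of the form `z x`. -/
def inducedRep [FiniteDimensional ℝ EG] [FiniteDimensional ℝ EN]
    [LieGroup 𝓘(ℝ, EG) ∞ G] [LieGroup 𝓘(ℝ, EN) ∞ N] [LieGroup 𝓘(ℝ, EH) ∞ H]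
    (hG : IsLieFactorization EG EN EH N H)
    (lam : Module.Dual ℝ (GroupLieAlgebra 𝓘(ℝ, EN) N)) (μ : Measure H) [μ.IsHaarMeasure]
    (g : G) (F : Lp ℂ 2 μ) : Lp ℂ 2 μ :=
  let p : H × N := hG.isComplement.symm.equiv g
  translation (EH := EH) μ p.1 (modulation hG lam μ (lieLog p.2) F)

/-! ### The chart, the map `Θ`, the weights, and the trigonometric system -/

variable {n : ℕ}

/-- `Θ_lam = P^* ∘ β_lam ∘ φ⁻¹`. Here `X` is a basis of `𝔫`, `P` is the projection of `𝔫` onto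
`𝔭 = span {X j : j ∈ J}` along the other basis vectors, and `𝔭^* = P^* 𝔫^*` is identified with
`J → ℝ` by the dual basis (`ξ ↦ (⟨ξ, X j⟩)_{j ∈ J}`). -/
def theta (lam : Module.Dual ℝ (GroupLieAlgebra 𝓘(ℝ, EN) N))
    (X : Module.Basis (Fin n) ℝ (GroupLieAlgebra 𝓘(ℝ, EN) N)) (J : Finset (Fin n))
    (φ : OpenPartialHomeomorph H EH) (A : EH) : J → ℝ :=
  fun j => beta lam (φ.symm A) (X j)

/-- The conditions on the chart `(𝒪, φ)` of `H` with values in the Lie algebra `𝔥` (which is `EH`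
as a vector space) and on `J`; here `𝒪 = φ.source` and `φ(𝒪) = φ.target`. The last three fields
say that `Θ_lam` is a diffeomorphism of `φ(𝒪)` onto a relatively compact open subset of `𝔭^*`. -/
structure IsAdmissibleChart (lam : Module.Dual ℝ (GroupLieAlgebra 𝓘(ℝ, EN) N))
    (X : Module.Basis (Fin n) ℝ (GroupLieAlgebra 𝓘(ℝ, EN) N)) (J : Finset (Fin n))
    (φ : OpenPartialHomeomorph H EH) : Prop where
  smooth_chart : φ ∈ IsManifold.maximalAtlas 𝓘(ℝ, EH) ∞ H
  one_mem : (1 : H) ∈ φ.source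
  map_one : φ 1 = 0
  connected : IsConnected φ.source
  relatively_compact : IsCompact (closure φ.source)
  theta_injOn : Set.InjOn (theta lam X J φ) φ.target
  theta_localDiffeo : IsLocalDiffeomorphOn 𝓘(ℝ, EH) 𝓘(ℝ, J → ℝ) ∞ (theta lam X J φ) φ.target
  theta_relatively_compact : IsCompact (closure (theta lam X J φ '' φ.target))

/-- `W_lam`, the Radon-Nikodym derivative, with respect to Lebesgue measure on `𝔭^*`, of the image
of the Haar measure on `𝒪` under `Θ_lam ∘ φ`. -/
def bigW (lam : Module.Dual ℝ (GroupLieAlgebra 𝓘(ℝ, EN) N))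
    (X : Module.Basis (Fin n) ℝ (GroupLieAlgebra 𝓘(ℝ, EN) N)) (J : Finset (Fin n))
    (φ : OpenPartialHomeomorph H EH) (μ : Measure H) (ξ : J → ℝ) : ℝ :=
  (((μ.restrict φ.source).map (fun h => theta lam X J φ (φ h))).rnDeriv volume ξ).toReal

/-- The weight `w(h) = W_lam(Θ_lam(φ(h)))`, relevant for `h ∈ 𝒪`. -/
def weight (lam : Module.Dual ℝ (GroupLieAlgebra 𝓘(ℝ, EN) N))
    (X : Module.Basis (Fin n) ℝ (GroupLieAlgebra 𝓘(ℝ, EN) N)) (J : Finset (Fin n))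
    (φ : OpenPartialHomeomorph H EH) (μ : Measure H) (h : H) : ℝ :=
  bigW lam X J φ μ (theta lam X J φ (φ h))

/-- The trigonometric system `{|C|^{-1/2} exp(2πi ⟨ξ, Y⟩) : Y ∈ log Γ}` is an orthonormal basis of
`L²(C, dξ)`, where `C ⊆ 𝔭^*` and `Γ ⊆ exp 𝔭`. -/
def IsTrigonometricBasis (X : Module.Basis (Fin n) ℝ (GroupLieAlgebra 𝓘(ℝ, EN) N))
    (J : Finset (Fin n)) (C : Set (J → ℝ)) (Γ : Set N) : Prop :=
  ∃ b : HilbertBasis Γ ℂ (Lp ℂ 2 (volume.restrict C)),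
    ∀ κ : Γ, (b κ : (J → ℝ) → ℂ) =ᵐ[volume.restrict C] fun ξ =>
      Complex.exp (2 * Real.pi * Complex.I * (∑ j : J, ξ j * X.repr (lieLog (κ : N)) j : ℝ)) /
        (Real.sqrt (volume.real C) : ℂ)

/-- `𝔭 = P 𝔫`, the span of the `X j` with `j ∈ J`. -/
def pSpace (X : Module.Basis (Fin n) ℝ (GroupLieAlgebra 𝓘(ℝ, EN) N)) (J : Finset (Fin n)) :
    Submodule ℝ (GroupLieAlgebra 𝓘(ℝ, EN) N) :=
  Submodule.span ℝ (X '' J)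

theorem memLp_window [T2Space H] [LieGroup 𝓘(ℝ, EH) ∞ H] (μ : Measure H) [μ.IsHaarMeasure]
    {f : H → ℂ} (hf : Continuous f) {s : Set H} (hs : IsCompact (closure s))
    (hfs : Function.support f ⊆ s) : MemLp f 2 μ :=
  hf.memLp_of_hasCompactSupport
    (HasCompactSupport.of_support_subset_isCompact hs (hfs.trans subset_closure))

end Setting

end LocalizedFrames

end

/-! On `𝒪` the map `T = P^* ∘ β_lam` is a smooth coordinate system, and for `Y ∈ 𝔭` the modulation
`π(exp Y)` is multiplication by the exponential `ξ ↦ exp(2πi ⟨ξ, Y⟩)` evaluated at `ξ = T h`. Fix `ℓ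
∈ Λ`. After pushing forward along `T`, the coefficients of `g` against `π(ℓ⁻¹ κ) f`, `κ ∈ Γ_N`, are
`|C|^{1/2}` times the coefficients in the trigonometric basis of a function on `C`. Parseval turns
their square sum into `|C| ∫ k(ℓh) |g(h)|² dμ(h)` with `k = |f|² w` (`tsum_enorm_integral_sq`).
Summing over `ℓ`, the frame inequalities compare `A‖g‖²` and `B‖g‖²` with the quadratic form of the
multiplier `|C| ∑ k(ℓh)`; testing on indicators gives the pointwise bounds (`ae_frame_bounds`).

Two points need care. The density `W` describes the image measure only if that measure is absolutely
continuous (`map_restrict_absolutelyContinuous`); this follows from left invariance and smoothness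
of right translations, without a Jacobian. Moreover `W` is only known to be integrable, so Parseval
applies at first only where the quadratic form is finite; the upper frame bound then shows that it
always is.

Boundedness of `f` comes from its continuity and the relative compactness of `𝒪`. -/

noncomputable section

namespace LocalizedFrames

/-! ### Inverses of injective local diffeomorphisms -/

section LocalDiffeo

variable {E F M : Type*} [NormedAddCommGroup E] [NormedSpace ℝ E] [NormedAddCommGroup F]
  [NormedSpace ℝ F] [TopologicalSpace M] [ChartedSpace E M]

theorem isLocalDiffeomorphAt_of_mem_maximalAtlas {φ : OpenPartialHomeomorph M E}
    (hφ : φ ∈ IsManifold.maximalAtlas 𝓘(ℝ, E) ∞ M) {x : M} (hx : x ∈ φ.source) :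
    IsLocalDiffeomorphAt 𝓘(ℝ, E) 𝓘(ℝ, E) ∞ φ x :=
  ⟨⟨φ.toPartialEquiv, φ.open_source, φ.open_target, contMDiffOn_of_mem_maximalAtlas hφ,
    contMDiffOn_symm_of_mem_maximalAtlas hφ⟩, hx, fun _ _ => rfl⟩

theorem isLocalDiffeomorphAt_congr_of_isOpen {T T' : M → F} {O : Set M} (hO : IsOpen O)
    (hTT : Set.EqOn T' T O) {x : M} (hx : x ∈ O)
    (h : IsLocalDiffeomorphAt 𝓘(ℝ, E) 𝓘(ℝ, F) ∞ T x) :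
    IsLocalDiffeomorphAt 𝓘(ℝ, E) 𝓘(ℝ, F) ∞ T' x := by
  obtain ⟨Φ, hΦ, hΦe⟩ := h
  let e := Φ.toOpenPartialHomeomorph.restrOpen O hO
  refine ⟨⟨e.toPartialEquiv, e.open_source, e.open_target,
    Φ.contMDiffOn_toFun.mono fun y hy => hy.1,
    Φ.contMDiffOn_invFun.mono fun y hy => hy.1⟩, ⟨hΦ, hx⟩, fun y hy => ?_⟩
  exact (hTT hy.2).trans (hΦe hy.1)

/-- By continuity the local inverse at `T x` takes values in `O` near `T x`, and injectivity on `O`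
leaves no other preimage there. The set-theoretic inverse thus inherits the smoothness of the local
ones. -/
theorem eventually_invFunOn_eq_localInverse [Nonempty M] {T : M → F} {O : Set M} (hO : IsOpen O)
    (hinj : Set.InjOn T O) {x : M} (hx : x ∈ O)
    (h : IsLocalDiffeomorphAt 𝓘(ℝ, E) 𝓘(ℝ, F) ∞ T x) :
    ∀ᶠ y in 𝓝 (T x), y ∈ T '' O ∧ Function.invFunOn T O y = h.localInverse y := by
  have hc : ContinuousAt h.localInverse (T x) := h.localInverse_contMDiffAt.continuousAt
  have hx' : h.localInverse (T x) = x := h.localInverse_left_inv h.localInverse_mem_target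
  have h1 : ∀ᶠ y in 𝓝 (T x), h.localInverse y ∈ O :=
    hc.eventually (by rw [hx']; exact hO.mem_nhds hx)
  filter_upwards [h1, h.localInverse_open_source.mem_nhds h.localInverse_mem_source] with y hy hy'
  have h2 : T (h.localInverse y) = y := h.localInverse_right_inv hy'
  have h3 : y ∈ T '' O := ⟨_, hy, h2⟩
  exact ⟨h3, hinj (Function.invFunOn_mem h3) hy ((Function.invFunOn_eq h3).trans h2.symm)⟩

theorem isOpen_image_of_isLocalDiffeomorphOn {T : M → F} {O : Set M} (hO : IsOpen O)
    (hinj : Set.InjOn T O) (h : ∀ x ∈ O, IsLocalDiffeomorphAt 𝓘(ℝ, E) 𝓘(ℝ, F) ∞ T x) :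
    IsOpen (T '' O) := by
  rw [isOpen_iff_mem_nhds]
  rintro _ ⟨x, hx, rfl⟩
  have : Nonempty M := ⟨x⟩
  exact (eventually_invFunOn_eq_localInverse hO hinj hx (h x hx)).mono fun _ h => h.1

theorem contMDiffAt_invFunOn [Nonempty M] {T : M → F} {O : Set M} (hO : IsOpen O)
    (hinj : Set.InjOn T O) (h : ∀ x ∈ O, IsLocalDiffeomorphAt 𝓘(ℝ, E) 𝓘(ℝ, F) ∞ T x)
    {y : F} (hy : y ∈ T '' O) :
    ContMDiffAt 𝓘(ℝ, F) 𝓘(ℝ, E) ∞ (Function.invFunOn T O) y := by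
  obtain ⟨x, hx, rfl⟩ := hy
  exact (h x hx).localInverse_contMDiffAt.congr_of_eventuallyEq
    ((eventually_invFunOn_eq_localInverse hO hinj hx (h x hx)).mono fun _ h => h.2)

/-- The inverse is continuous on the open set `T '' O`; a constant value elsewhere makes it
measurable on all of `F`, as Tonelli and changes of variables require. -/
theorem exists_measurable_eqOn_invFunOn [Nonempty M] [MeasurableSpace F] [BorelSpace F]
    [MeasurableSpace M] [BorelSpace M] {T : M → F} {O : Set M} (hO : IsOpen O)
    (hinj : Set.InjOn T O) (h : ∀ x ∈ O, IsLocalDiffeomorphAt 𝓘(ℝ, E) 𝓘(ℝ, F) ∞ T x) :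
    ∃ S : F → M, Measurable S ∧ ∀ a ∈ T '' O, S a = Function.invFunOn T O a := by
  classical
  obtain ⟨x₀⟩ := ‹Nonempty M›
  have hSc : ContinuousOn (Function.invFunOn T O) (T '' O) := fun a ha =>
    (contMDiffAt_invFunOn hO hinj h ha).continuousAt.continuousWithinAt
  exact ⟨(T '' O).piecewise (Function.invFunOn T O) (fun _ => x₀),
    hSc.measurable_piecewise continuousOn_const
      (isOpen_image_of_isLocalDiffeomorphOn hO hinj h).measurableSet,
    fun a ha => Set.piecewise_eq_of_mem _ _ _ ha⟩

end LocalDiffeo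

/-! ### Absolute continuity of Haar measure in smooth coordinates -/

section AbsolutelyContinuous

variable {E F H : Type*} [NormedAddCommGroup E] [NormedSpace ℝ E]
  [NormedAddCommGroup F] [NormedSpace ℝ F] [FiniteDimensional ℝ F] [MeasurableSpace F]
  [BorelSpace F] [TopologicalSpace H] [ChartedSpace E H] [Group H] [LieGroup 𝓘(ℝ, E) ∞ H]

/-- Right translation, read in a smooth coordinate system `T` on `O`, preserves null sets. -/
theorem measure_preimage_mul_right_eq_zero (m : Measure F) [m.IsAddHaarMeasure] {T : H → F}
    {O : Set H} (hO : IsOpen O) (hinj : Set.InjOn T O)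
    (h : ∀ x ∈ O, IsLocalDiffeomorphAt 𝓘(ℝ, E) 𝓘(ℝ, F) ∞ T x) {Z : Set F} (hZ : m Z = 0) (x : H) :
    m {a ∈ T '' O | Function.invFunOn T O a * x ∈ O ∩ T ⁻¹' Z} = 0 := by
  set S := Function.invFunOn T O
  set D : Set F := {a ∈ T '' O | S a * x⁻¹ ∈ O}
  have hdiff : DifferentiableOn ℝ (fun a => T (S a * x⁻¹)) (Z ∩ D) := by
    rintro a ⟨-, ha, hax⟩
    have h1 : ContMDiffAt 𝓘(ℝ, F) 𝓘(ℝ, E) ∞ (fun a => S a * x⁻¹) a :=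
      (contMDiffAt_invFunOn hO hinj h ha).mul contMDiffAt_const
    have h2 : ContMDiffAt 𝓘(ℝ, F) 𝓘(ℝ, F) ∞ (fun a => T (S a * x⁻¹)) a :=
      ContMDiffAt.comp a (h _ hax).contMDiffAt h1
    exact (h2.contDiffAt.differentiableAt (by simp)).differentiableWithinAt
  -- The set lies in the image of `Z ∩ D` under right translation by `x⁻¹` read in coordinates, and
  -- differentiable maps between spaces of equal dimension preserve null sets.
  refine measure_mono_null ?_ (addHaar_image_eq_zero_of_differentiableOn_of_addHaar_eq_zero m hdiff
    (measure_mono_null Set.inter_subset_left hZ))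
  rintro _ ⟨⟨y, hy, rfl⟩, hyx, hyZ⟩
  have hS : ∀ z ∈ O, S (T z) = z := fun z hz => hinj.leftInvOn_invFunOn hz
  rw [hS y hy] at hyx hyZ
  refine ⟨T (y * x), ⟨hyZ, ⟨_, hyx, rfl⟩, ?_⟩, ?_⟩ <;> simp [hS _ hyx, hy]

/-- In a smooth coordinate system `T` on an open set `O` of a Lie group, a left Haar measure is
absolutely continuous with respect to Lebesgue measure. -/
theorem map_restrict_absolutelyContinuous [SecondCountableTopology H] [MeasurableSpace H]
    [BorelSpace H] (μ : Measure H) [μ.IsHaarMeasure] [SigmaFinite μ] (m : Measure F)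
    [m.IsAddHaarMeasure] {T : H → F} (hT : Measurable T) {O : Set H} (hO : IsOpen O)
    (hinj : Set.InjOn T O) (h : ∀ x ∈ O, IsLocalDiffeomorphAt 𝓘(ℝ, E) 𝓘(ℝ, F) ∞ T x) :
    (μ.restrict O).map T ≪ m := by
  have := topologicalGroup_of_lieGroup 𝓘(ℝ, E) ∞ (G := H)
  rcases O.eq_empty_or_nonempty with rfl | hne
  · simp [Measure.AbsolutelyContinuous.zero]
  refine Measure.AbsolutelyContinuous.mk fun Z hZm hZ => ?_
  rw [Measure.map_apply hT hZm, Measure.restrict_apply (hT hZm), Set.inter_comm]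
  set W := O ∩ T ⁻¹' Z
  have hWm : MeasurableSet W := hO.measurableSet.inter (hT hZm)
  set Ω := T '' O
  have hΩ : IsOpen Ω := isOpen_image_of_isLocalDiffeomorphOn hO hinj h
  obtain ⟨S, hSm, hS'⟩ := exists_measurable_eqOn_invFunOn hO hinj h
  have hPm : MeasurableSet {p : F × H | p.1 ∈ Ω ∧ S p.1 * p.2 ∈ W} :=
    (measurable_fst hΩ.measurableSet).inter (((hSm.comp measurable_fst).mul measurable_snd) hWm)
  -- Tonelli in both orders: slices at fixed `x` are null by the previous lemma, hence almost all
  -- slices at fixed `a` are `μ`-null.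
  have h0 : (m.prod μ) {p : F × H | p.1 ∈ Ω ∧ S p.1 * p.2 ∈ W} = 0 := by
    rw [Measure.prod_apply_symm hPm]
    refine lintegral_eq_zero_of_ae_eq_zero (Filter.Eventually.of_forall fun x => ?_)
    refine measure_mono_null ?_ (measure_preimage_mul_right_eq_zero m hO hinj h hZ x)
    rintro a ⟨ha, haW⟩
    exact ⟨ha, by rwa [← hS' a ha]⟩
  rw [Measure.measure_prod_null hPm] at h0
  have hΩ0 : m Ω ≠ 0 := (hΩ.measure_pos m (hne.image T)).ne'
  by_contra hμ
  -- The slice at `a ∈ Ω` is `(S a)⁻¹ W`, of measure `μ W` by left invariance. If `μ W ≠ 0`, every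
  -- point of the nonempty open set `Ω` would be exceptional.
  refine hΩ0 (measure_mono_null (fun a ha => ?_) h0)
  have h1 : Prod.mk a ⁻¹' {p : F × H | p.1 ∈ Ω ∧ S p.1 * p.2 ∈ W} = (fun y => S a * y) ⁻¹' W := by
    ext y
    simp [ha]
  simpa only [Set.mem_compl_iff, Set.mem_ofPred_eq, h1, measure_preimage_mul, Pi.zero_apply] using hμ

end AbsolutelyContinuous

/-! ### Parseval on `C`, transported to the group -/

section Plancherel

theorem enorm_sq_eq_ofReal {𝓗 : Type*} [SeminormedAddCommGroup 𝓗] (x : 𝓗) :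
    ‖x‖ₑ ^ 2 = ENNReal.ofReal (‖x‖ ^ 2) := by
  rw [ENNReal.ofReal_pow (norm_nonneg x), ofReal_norm]

theorem hilbertBasis_tsum_enorm_inner_sq {ι 𝓗 : Type*} [NormedAddCommGroup 𝓗]
    [InnerProductSpace ℂ 𝓗] (b : HilbertBasis ι ℂ 𝓗) (u : 𝓗) :
    ∑' i, ‖inner ℂ (b i) u‖ₑ ^ 2 = ‖u‖ₑ ^ 2 := by
  have h : HasSum (fun i => ‖inner ℂ (b i) u‖ ^ 2) (‖u‖ ^ 2) := by
    have h1 := (b.hasSum_inner_mul_inner u u).mapL Complex.reCLM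
    have h2 : (Complex.reCLM (inner ℂ u u) : ℝ) = ‖u‖ ^ 2 := by
      rw [inner_self_eq_norm_sq_to_K]
      simp [← Complex.ofReal_pow]
    rw [h2] at h1
    refine h1.congr_fun fun i => ?_
    rw [← inner_conj_symm u, Complex.reCLM_apply]
    change _ = ((starRingEnd ℂ) _ * _ : ℂ).re
    rw [Complex.conj_mul']
    simp [← Complex.ofReal_pow]
  simp only [enorm_sq_eq_ofReal]
  rw [← h.tsum_eq, ENNReal.ofReal_tsum_of_nonneg (fun _ => sq_nonneg _) h.summable]

theorem enorm_sq_eq_lintegral {α : Type*} [MeasurableSpace α] {μ : Measure α} (u : Lp ℂ 2 μ) :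
    ‖u‖ₑ ^ 2 = ∫⁻ x, ‖u x‖ₑ ^ 2 ∂μ := by
  rw [Lp.enorm_def, eLpNorm_eq_lintegral_rpow_enorm_toReal (by simp) (by simp), ← ENNReal.rpow_natCast,
    ← ENNReal.rpow_mul]
  simp

variable {ι F H : Type*} [MeasurableSpace F] [MeasurableSpace H]

/-- Plancherel's formula on the image of `O` under the coordinates `T`, written on `H`. -/
theorem tsum_enorm_integral_sq {μ : Measure H} {m : Measure F} [SigmaFinite m] {O : Set H}
    (hO : MeasurableSet O) (hμO : μ O ≠ ⊤) {T : H → F} (hT : Measurable T) {S : F → H}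
    (hS : Measurable S) (hST : ∀ h ∈ O, S (T h) = h)
    (hac : (μ.restrict O).map T ≪ m) {C : Set F} (hC : MeasurableSet C) (hTC : T '' O ⊆ C)
    (hC0 : m C ≠ 0) (hC1 : m C ≠ ⊤)
    (e : ι → F → ℂ) (he : ∀ i, Measurable (e i))
    (b : HilbertBasis ι ℂ (Lp ℂ 2 (m.restrict C)))
    (hb : ∀ i, (b i : F → ℂ) =ᵐ[m.restrict C] fun ξ => e i ξ / (Real.sqrt (m.real C) : ℂ))
    {f q : H → ℂ} (hf : Measurable f) (hfO : Function.support f ⊆ O) (hq : Measurable q)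
    (hfin : ∫⁻ h, ENNReal.ofReal (‖f h‖ ^ 2 *
      (((μ.restrict O).map T).rnDeriv m (T h)).toReal) * ‖q h‖ₑ ^ 2 ∂μ ≠ ⊤) :
    ∑' i, ‖∫ h, inner ℂ (e i (T h) * f h) (q h) ∂μ‖ₑ ^ 2 =
      m C * ∫⁻ h, ENNReal.ofReal (‖f h‖ ^ 2 *
        (((μ.restrict O).map T).rnDeriv m (T h)).toReal) * ‖q h‖ₑ ^ 2 ∂μ := by
  set ν := (μ.restrict O).map T with hν
  have : IsFiniteMeasure (μ.restrict O) := ⟨by simpa [lt_top_iff_ne_top] using hμO⟩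
  have : IsFiniteMeasure ν := Measure.isFiniteMeasure_map _ _
  set W : F → ℝ := fun ξ => (ν.rnDeriv m ξ).toReal with hW
  have hWm : Measurable W := (Measure.measurable_rnDeriv ν m).ennreal_toReal
  have hνC : ν Cᶜ = 0 := by
    rw [hν, Measure.map_apply hT hC.compl, Measure.restrict_apply (hT hC.compl)]
    convert measure_empty (μ := μ)
    ext h
    simp only [Set.mem_inter_iff, Set.mem_preimage, Set.mem_compl_iff, Set.mem_empty_iff_false,
      iff_false, not_and]
    exact fun h1 h2 => h1 (hTC ⟨h, h2, rfl⟩)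
  have hνres : ν.restrict C = ν := Measure.restrict_eq_self_of_ae_mem (hνC)
  -- One factor `W` converts integrals against `m` into integrals against `ν`. In `|u|²` it occurs
  -- twice: one copy is absorbed in returning to `μ`, the other survives as the weight.
  set u : F → ℂ := fun ξ => (starRingEnd ℂ) (f (S ξ)) * q (S ξ) * W ξ with hu
  have hum : Measurable u := by
    have h1 : Measurable fun ξ => (starRingEnd ℂ) (f (S ξ)) :=
      Complex.continuous_conj.measurable.comp (hf.comp hS)
    exact (h1.mul (hq.comp hS)).mul (Complex.measurable_ofReal.comp hWm)
  -- Taking `toReal` alters the density only where it is infinite, a null set.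
  have hWfin : ∀ᵐ ξ ∂m, ENNReal.ofReal (W ξ) = ν.rnDeriv m ξ := by
    filter_upwards [Measure.rnDeriv_lt_top ν m] with ξ hξ
    exact ENNReal.ofReal_toReal hξ.ne
  have key : ∫⁻ ξ in C, ‖u ξ‖ₑ ^ 2 ∂m =
      ∫⁻ h, ENNReal.ofReal (‖f h‖ ^ 2 * W (T h)) * ‖q h‖ₑ ^ 2 ∂μ := by
    set v : F → ENNReal := fun ξ =>
      ENNReal.ofReal (‖f (S ξ)‖ ^ 2 * W ξ) * ‖q (S ξ)‖ₑ ^ 2 with hv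
    have hvm : Measurable v :=
      ((((hf.comp hS).norm.pow_const 2).mul hWm).ennreal_ofReal).mul
        ((hq.comp hS).enorm.pow_const 2)
    have h1 : ∫⁻ ξ in C, ‖u ξ‖ₑ ^ 2 ∂m = ∫⁻ ξ in C, ν.rnDeriv m ξ * v ξ ∂m := by
      refine lintegral_congr_ae (ae_restrict_of_ae ?_)
      filter_upwards [hWfin] with ξ hξ
      have hW0 : 0 ≤ W ξ := ENNReal.toReal_nonneg
      rw [← hξ, hv, enorm_sq_eq_ofReal]
      simp only
      rw [enorm_sq_eq_ofReal, ← ENNReal.ofReal_mul (by positivity),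
        ← ENNReal.ofReal_mul hW0]
      congr 1
      simp only [hu, norm_mul, RCLike.norm_conj, Complex.norm_real, Real.norm_eq_abs,
        abs_of_nonneg hW0]
      ring
    rw [h1, setLIntegral_rnDeriv_mul hac hvm.aemeasurable hC, hνres, hν, lintegral_map hvm hT,
      setLIntegral_congr_fun (g := fun h => ENNReal.ofReal (‖f h‖ ^ 2 * W (T h)) * ‖q h‖ₑ ^ 2) hO
        (fun h hh => by simp only [hv, hST h hh])]
    refine setLIntegral_eq_of_support_subset fun h hh => hfO fun h0 => hh ?_
    simp [h0]
  -- Integrability of `W` does not make `u` square integrable; this is where `hfin` enters.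
  have huL : MemLp u 2 (m.restrict C) := by
    refine ⟨hum.aestronglyMeasurable, ?_⟩
    rw [eLpNorm_lt_top_iff_lintegral_rpow_enorm_lt_top (by simp) (by simp)]
    rw [← key] at hfin
    simpa [lt_top_iff_ne_top] using hfin
  -- The factor `m C` undoes the normalization `|C|^{-1/2}` of the basis.
  have hcoef : ∀ i, ‖∫ h, inner ℂ (e i (T h) * f h) (q h) ∂μ‖ₑ ^ 2 =
      m C * ‖inner ℂ (b i) huL.toLp‖ₑ ^ 2 := by
    intro i
    have hr : 0 < m.real C := ENNReal.toReal_pos hC0 hC1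
    have h1 : inner ℂ (b i) huL.toLp =
        (Real.sqrt (m.real C) : ℂ)⁻¹ * ∫ h, inner ℂ (e i (T h) * f h) (q h) ∂μ := by
      set G : F → ℂ := fun ξ => inner ℂ (e i ξ * f (S ξ)) (q (S ξ)) with hG
      have hGm : Measurable G := by
        have h2 : Measurable fun ξ => (starRingEnd ℂ) (e i ξ * f (S ξ)) :=
          Complex.continuous_conj.measurable.comp ((he i).mul (hf.comp hS))
        exact (hq.comp hS).mul h2
      calc inner ℂ (b i) huL.toLp
          = ∫ ξ in C, (Real.sqrt (m.real C) : ℂ)⁻¹ * ((ν.rnDeriv m ξ).toReal • G ξ) ∂m := by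
            rw [L2.inner_def]
            refine integral_congr_ae ?_
            filter_upwards [hb i, huL.coeFn_toLp] with ξ h2 h3
            rw [h2, h3]
            simp only [hG, hu, hW, RCLike.inner_apply, map_mul, map_div₀, Complex.conj_ofReal,
              Complex.real_smul]
            ring
        _ = (Real.sqrt (m.real C) : ℂ)⁻¹ * ∫ ξ, G ξ ∂ν := by
            rw [integral_const_mul, setIntegral_rnDeriv_smul hac hC, hνres]
        _ = (Real.sqrt (m.real C) : ℂ)⁻¹ * ∫ h in O, inner ℂ (e i (T h) * f h) (q h) ∂μ := by
            rw [hν, integral_map hT.aemeasurable hGm.aestronglyMeasurable]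
            congr 1
            refine setIntegral_congr_fun hO fun h hh => ?_
            simp only [hG, hST h hh]
        _ = _ := by
            rw [setIntegral_eq_integral_of_forall_compl_eq_zero]
            intro h hh
            rw [Function.notMem_support.mp fun h' => hh (hfO h')]
            simp
    rw [h1, enorm_mul, mul_pow, ← mul_assoc]
    have h2 : m C * ‖(Real.sqrt (m.real C) : ℂ)⁻¹‖ₑ ^ 2 = 1 := by
      rw [enorm_sq_eq_ofReal, norm_inv, Complex.norm_real, Real.norm_eq_abs, inv_pow, sq_abs,
        Real.sq_sqrt hr.le, ENNReal.ofReal_inv_of_pos hr, ofReal_measureReal hC1,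
        ENNReal.mul_inv_cancel hC0 hC1]
    rw [h2, one_mul]
  simp_rw [hcoef]
  rw [ENNReal.tsum_mul_left, hilbertBasis_tsum_enorm_inner_sq, enorm_sq_eq_lintegral, ← key]
  congr 1
  refine lintegral_congr_ae ?_
  filter_upwards [huL.coeFn_toLp] with ξ h
  rw [h]

end Plancherel

/-! ### From quadratic forms to pointwise bounds -/

section FrameBounds

variable {α L : Type*} [MeasurableSpace α] {μ : Measure α}

theorem exists_lp_enorm_sq_eq_indicator {s : Set α} (hs : MeasurableSet s) (hμs : μ s ≠ ⊤) :
    ∃ g : Lp ℂ 2 μ, (∀ᵐ x ∂μ, ‖g x‖ₑ ^ 2 = s.indicator 1 x) := by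
  refine ⟨indicatorConstLp 2 hs hμs 1, ?_⟩
  filter_upwards [indicatorConstLp_coeFn (p := 2) (hs := hs) (hμs := hμs) (c := (1 : ℂ))] with x hx
  rw [hx]
  by_cases h : x ∈ s <;> simp [h]

theorem lintegral_mul_enorm_sq_of_indicator {s : Set α} (hs : MeasurableSet s) {g : Lp ℂ 2 μ}
    (hg : ∀ᵐ x ∂μ, ‖g x‖ₑ ^ 2 = s.indicator 1 x) (k : α → ENNReal) :
    ∫⁻ x, k x * ‖g x‖ₑ ^ 2 ∂μ = ∫⁻ x in s, k x ∂μ := by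
  rw [← lintegral_indicator hs]
  refine lintegral_congr_ae ?_
  filter_upwards [hg] with x hx
  rw [hx]
  by_cases h : x ∈ s <;> simp [h]

theorem enorm_sq_of_indicator {s : Set α} (hs : MeasurableSet s) {g : Lp ℂ 2 μ}
    (hg : ∀ᵐ x ∂μ, ‖g x‖ₑ ^ 2 = s.indicator 1 x) : ‖g‖ₑ ^ 2 = μ s := by
  have := lintegral_mul_enorm_sq_of_indicator hs hg 1
  simpa [enorm_sq_eq_lintegral] using this

variable [SigmaFinite μ]

/-- A multiplier `k` whose quadratic form is bounded by `b`, as soon as it is finite, is bounded by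
`b` almost everywhere. -/
theorem ae_le_of_lintegral_mul_enorm_sq_le {k : α → ENNReal} (hk : Measurable k)
    (hk' : ∀ x, k x ≠ ⊤) {b V : ENNReal}
    (h : ∀ g : Lp ℂ 2 μ, ∫⁻ x, k x * ‖g x‖ₑ ^ 2 ∂μ ≠ ⊤ →
      V * ∫⁻ x, k x * ‖g x‖ₑ ^ 2 ∂μ ≤ b * ‖g‖ₑ ^ 2) :
    ∀ᵐ x ∂μ, V * k x ≤ b := by
  -- The hypothesis speaks only of `g` with finite form, so indicators are taken inside `{k ≤ m}`;
  -- these sets exhaust the space because `k` is finite everywhere.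
  have main : ∀ m : ℕ, ∀ᵐ x ∂μ, (V * {x | k x ≤ m}.indicator k x) ≤ b := by
    intro m
    have hm : MeasurableSet {x | k x ≤ m} := measurableSet_le hk measurable_const
    refine ae_le_of_forall_setLIntegral_le_of_sigmaFinite (g := fun _ => b)
      ((hk.indicator hm).const_mul V) fun s hs hμs => ?_
    have hsm : MeasurableSet ({x | k x ≤ m} ∩ s) := hm.inter hs
    have hle : μ ({x | k x ≤ m} ∩ s) ≤ μ s := measure_mono Set.inter_subset_right
    obtain ⟨g, hg⟩ := exists_lp_enorm_sq_eq_indicator hsm (hle.trans_lt hμs).ne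
    have h1 := h g
    rw [lintegral_mul_enorm_sq_of_indicator hsm hg, enorm_sq_of_indicator hsm hg] at h1
    rw [lintegral_const_mul _ (hk.indicator hm), lintegral_indicator hm,
      Measure.restrict_restrict hm, setLIntegral_const]
    refine (h1 (ne_of_lt ?_)).trans (by gcongr)
    calc ∫⁻ x in {x | k x ≤ m} ∩ s, k x ∂μ ≤ ∫⁻ _ in {x | k x ≤ m} ∩ s, (m : ENNReal) ∂μ :=
          setLIntegral_mono measurable_const fun x hx => hx.1
      _ ≤ m * μ s := by rw [setLIntegral_const]; gcongr
      _ < ⊤ := ENNReal.mul_lt_top (ENNReal.natCast_lt_top m) hμs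
  filter_upwards [ae_all_iff.mpr main] with x hx
  obtain ⟨m, hm⟩ := ENNReal.exists_nat_gt (hk' x)
  have := hx m
  rwa [Set.indicator_of_mem (show x ∈ {x | k x ≤ m} from hm.le)] at this

/-- If the frame sums split into quadratic forms of multipliers `K l`, the frame bounds are almost
everywhere bounds for the sum of the `K l`. -/
theorem ae_frame_bounds [Countable L] {K : L → α → ENNReal} (hK : ∀ l, Measurable (K l))
    (hK' : ∀ l x, K l x ≠ ⊤) {a b V : ENNReal} (hb : b ≠ ⊤) (hV : V ≠ 0)
    {c : L → Lp ℂ 2 μ → ENNReal}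
    (hc : ∀ l g, ∫⁻ x, K l x * ‖g x‖ₑ ^ 2 ∂μ ≠ ⊤ → c l g = V * ∫⁻ x, K l x * ‖g x‖ₑ ^ 2 ∂μ)
    (hlow : ∀ g, a * ‖g‖ₑ ^ 2 ≤ ∑' l, c l g) (hup : ∀ g, ∑' l, c l g ≤ b * ‖g‖ₑ ^ 2) :
    ∀ᵐ x ∂μ, a ≤ V * ∑' l, K l x ∧ V * ∑' l, K l x ≤ b := by
  -- A single term is at most the whole frame sum, so each `V * K l` is already bounded by `b`.
  have hone : ∀ l, ∀ᵐ x ∂μ, V * K l x ≤ b := fun l =>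
    ae_le_of_lintegral_mul_enorm_sq_le (hK l) (hK' l) fun g hg => by
      rw [← hc l g hg]
      exact (ENNReal.le_tsum l).trans (hup g)
  -- Being essentially bounded, `K l` has a finite form on all of `L²`, and the formula `hc` becomes
  -- unconditional.
  have hfin : ∀ l (g : Lp ℂ 2 μ), ∫⁻ x, K l x * ‖g x‖ₑ ^ 2 ∂μ ≠ ⊤ := by
    intro l g hg
    have hgm : Measurable fun x => ‖g x‖ₑ ^ 2 :=
      (Lp.stronglyMeasurable g).measurable.enorm.pow_const 2
    have hKg : Measurable fun x => K l x * ‖g x‖ₑ ^ 2 := (hK l).mul hgm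
    have h1 : V * ∫⁻ x, K l x * ‖g x‖ₑ ^ 2 ∂μ ≤ b * ‖g‖ₑ ^ 2 := by
      rw [enorm_sq_eq_lintegral, ← lintegral_const_mul _ hKg, ← lintegral_const_mul _ hgm]
      refine lintegral_mono_ae ?_
      filter_upwards [hone l] with x hx
      rw [← mul_assoc]
      gcongr
    rw [hg, ENNReal.mul_top hV, top_le_iff] at h1
    exact ENNReal.mul_ne_top hb (by simp) h1
  have hsum : ∀ (s : Set α), MeasurableSet s → μ s < ⊤ → ∃ g : Lp ℂ 2 μ,
      ‖g‖ₑ ^ 2 = μ s ∧ ∑' l, c l g = ∫⁻ x in s, V * ∑' l, K l x ∂μ := by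
    intro s hs hμs
    obtain ⟨g, hg⟩ := exists_lp_enorm_sq_eq_indicator hs hμs.ne
    refine ⟨g, enorm_sq_of_indicator hs hg, ?_⟩
    rw [lintegral_const_mul _ (Measurable.tsum hK), lintegral_tsum fun l => (hK l).aemeasurable,
      ← ENNReal.tsum_mul_left]
    exact tsum_congr fun l => by
      rw [hc l g (hfin l g), lintegral_mul_enorm_sq_of_indicator hs hg]
  refine Filter.Eventually.and ?_ ?_
  · refine ae_le_of_forall_setLIntegral_le_of_sigmaFinite measurable_const fun s hs hμs => ?_
    obtain ⟨g, h1, h2⟩ := hsum s hs hμs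
    rw [setLIntegral_const, ← h1, ← h2]
    exact hlow g
  · refine ae_le_of_forall_setLIntegral_le_of_sigmaFinite
      ((Measurable.tsum hK).const_mul V) fun s hs hμs => ?_
    obtain ⟨g, h1, h2⟩ := hsum s hs hμs
    rw [setLIntegral_const, ← h1, ← h2]
    exact hup g

end FrameBounds

/-! ### Frame sums in `[0, ∞]` and their index set -/

section Frame

variable {ι 𝓗 : Type*} [NormedAddCommGroup 𝓗] [InnerProductSpace ℂ 𝓗]

theorem IsFrame.tsum_enorm_bounds {v : ι → 𝓗} {A B : ℝ} (h : IsFrame v A B) (g : 𝓗) :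
    ENNReal.ofReal A * ‖g‖ₑ ^ 2 ≤ ∑' i, ‖inner ℂ (v i) g‖ₑ ^ 2 ∧
      ∑' i, ‖inner ℂ (v i) g‖ₑ ^ 2 ≤ ENNReal.ofReal B * ‖g‖ₑ ^ 2 := by
  simp only [enorm_sq_eq_ofReal]
  rw [← ENNReal.ofReal_tsum_of_nonneg (fun _ => sq_nonneg _) (h.summable g),
    ← ENNReal.ofReal_mul h.pos.le, ← ENNReal.ofReal_mul (h.pos.le.trans h.le)]
  exact ⟨ENNReal.ofReal_le_ofReal (h.lower g), ENNReal.ofReal_le_ofReal (h.upper g)⟩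

end Frame

/-- The products `l⁻¹ κ` with `l ∈ Λ` and `κ ∈ Γ` are pairwise distinct. -/
theorem tsum_inv_mul {G : Type*} [Group G] {N H : Subgroup G} (hNH : N.IsComplement' H) (Λ : Set H)
    (Γ : Set N) (c : G → ENNReal) :
    ∑' x : ((((↑) : H → G) '' Λ)⁻¹ * (((↑) : N → G) '' Γ) : Set G), c x =
      ∑' l : Λ, ∑' κ : Γ, c (((l : H)⁻¹ : H) * ((κ : N) : G)) := by
  let ψ : Λ × Γ → ((((↑) : H → G) '' Λ)⁻¹ * (((↑) : N → G) '' Γ) : Set G) := fun p =>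
    ⟨(((p.1 : H)⁻¹ : H) : G) * ((p.2 : N) : G), Set.mul_mem_mul
      (by simp) ⟨p.2, p.2.2, rfl⟩⟩
  have hψ : Function.Bijective ψ := by
    refine ⟨?_, ?_⟩
    · rintro ⟨l, κ⟩ ⟨l', κ'⟩ h
      have h1 : (((l : H)⁻¹ : H), (κ : N)) = (((l' : H)⁻¹ : H), (κ' : N)) :=
        hNH.symm.equiv.symm.injective (by
          simpa only [hNH.symm.equiv_symm_apply] using congrArg Subtype.val h)
      simp only [Prod.mk.injEq, inv_inj] at h1
      exact Prod.ext (Subtype.ext h1.1) (Subtype.ext h1.2)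
    · rintro ⟨_, a, ha, _, ⟨κ, hκ, rfl⟩, rfl⟩
      obtain ⟨l, hl, hla⟩ := ha
      refine ⟨(⟨l, hl⟩, ⟨κ, hκ⟩), Subtype.ext ?_⟩
      simp [ψ, hla]
  rw [← (Equiv.ofBijective ψ hψ).tsum_eq, ENNReal.tsum_prod']
  rfl

/-! ### Coordinates on `𝒪` and coefficients of the representation -/

section Setting

open Manifold

variable {EG EN EH G : Type*}
  [NormedAddCommGroup EG] [NormedSpace ℝ EG] [NormedAddCommGroup EN] [NormedSpace ℝ EN]
  [NormedAddCommGroup EH] [NormedSpace ℝ EH]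
  [TopologicalSpace G] [ChartedSpace EG G] [Group G]

theorem lieLog_lieExp [FiniteDimensional ℝ EN] {K : Type*} [TopologicalSpace K]
    [ChartedSpace EN K] [Group K] [LieGroup 𝓘(ℝ, EN) ∞ K] (hK : IsExponentialSolvable EN K)
    (Y : GroupLieAlgebra 𝓘(ℝ, EN) K) : lieLog (lieExp Y) = Y := by
  obtain ⟨e, he⟩ := hK.exp_diffeomorph
  have hinj : Function.Injective (lieExp (E := EN) (K := K)) := fun Y Z h =>
    e.injective ((he Y).trans (h.trans (he Z).symm))
  exact Function.leftInverse_invFun hinj Y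

variable {N H : Subgroup G} [N.Normal] [ChartedSpace EN N] [ChartedSpace EH H] {n : ℕ}

/-- Coordinates of `Y` outside `J` vanish, so the phase depends on `h` only through `P^* (β_lam h)`.
This makes the modulations exponentials on `C`. -/
theorem beta_eq_sum_of_mem_pSpace (lam : Module.Dual ℝ (GroupLieAlgebra 𝓘(ℝ, EN) N)) (h : H)
    (X : Module.Basis (Fin n) ℝ (GroupLieAlgebra 𝓘(ℝ, EN) N)) (J : Finset (Fin n))
    {Y : GroupLieAlgebra 𝓘(ℝ, EN) N} (hY : Y ∈ pSpace X J) :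
    beta lam h Y = ∑ j : J, beta lam h (X j) * X.repr Y j := by
  have hsupp : ∀ i, i ∉ J → X.repr Y i = 0 := by
    intro i hi
    by_contra h0
    exact hi (X.mem_span_image.mp hY (Finsupp.mem_support_iff.mpr h0))
  calc beta lam h Y = beta lam h (∑ i, X.repr Y i • X i) := by rw [X.sum_repr]
    _ = ∑ i, beta lam h (X i) * X.repr Y i := by
      simp only [map_sum, map_smul, smul_eq_mul, mul_comm]
    _ = ∑ i ∈ J, beta lam h (X i) * X.repr Y i :=
      (Finset.sum_subset (Finset.subset_univ J) fun i _ hi => by rw [hsupp i hi, mul_zero]).symm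
    _ = _ := (Finset.sum_coe_sort J fun i => beta lam h (X i) * X.repr Y i).symm

/-- The map `P^* ∘ β_lam` on `H`, in coordinates. -/
def projBeta (lam : Module.Dual ℝ (GroupLieAlgebra 𝓘(ℝ, EN) N))
    (X : Module.Basis (Fin n) ℝ (GroupLieAlgebra 𝓘(ℝ, EN) N)) (J : Finset (Fin n)) (h : H) :
    J → ℝ :=
  fun j => beta lam h (X j)

section Chart

variable {lam : Module.Dual ℝ (GroupLieAlgebra 𝓘(ℝ, EN) N)}
  {X : Module.Basis (Fin n) ℝ (GroupLieAlgebra 𝓘(ℝ, EN) N)} {J : Finset (Fin n)}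
  {φ : OpenPartialHomeomorph H EH}

/-- On `𝒪` the chart cancels. This allows `Θ_lam ∘ φ` to be replaced by a map that is continuous on
all of `H`. -/
theorem theta_apply_chart {h : H} (hh : h ∈ φ.source) :
    theta lam X J φ (φ h) = projBeta lam X J h := by
  funext j
  simp only [theta, projBeta, φ.left_inv hh]

theorem IsAdmissibleChart.projBeta_injOn (hφ : IsAdmissibleChart lam X J φ) :
    Set.InjOn (projBeta lam X J : H → J → ℝ) φ.source := by
  intro x hx y hy hxy
  rw [← theta_apply_chart hx, ← theta_apply_chart hy] at hxy
  exact φ.injOn hx hy (hφ.theta_injOn (φ.map_source hx) (φ.map_source hy) hxy)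

theorem IsAdmissibleChart.projBeta_isLocalDiffeomorphAt (hφ : IsAdmissibleChart lam X J φ) {x : H}
    (hx : x ∈ φ.source) :
    IsLocalDiffeomorphAt 𝓘(ℝ, EH) 𝓘(ℝ, J → ℝ) ∞ (projBeta lam X J : H → J → ℝ) x := by
  have h : IsLocalDiffeomorphAt 𝓘(ℝ, EH) 𝓘(ℝ, J → ℝ) ∞ (theta lam X J φ ∘ φ) x :=
    (isLocalDiffeomorphAt_of_mem_maximalAtlas hφ.smooth_chart hx).comp _ _
      (hφ.theta_localDiffeo ⟨φ x, φ.map_source hx⟩)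
  exact isLocalDiffeomorphAt_congr_of_isOpen φ.open_source
    (fun y hy => (theta_apply_chart hy).symm) hx h

theorem projBeta_image_source (φ : OpenPartialHomeomorph H EH) :
    projBeta lam X J '' φ.source = theta lam X J φ '' φ.target := by
  rw [← φ.image_source_eq_target, Set.image_image]
  exact Set.image_congr fun h hh => (theta_apply_chart hh).symm

theorem weight_eq [MeasurableSpace H] [BorelSpace H] (μ : Measure H) {h : H} (hh : h ∈ φ.source) :
    weight lam X J φ μ h =
      (((μ.restrict φ.source).map (projBeta lam X J)).rnDeriv volume (projBeta lam X J h)).toReal := by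
  have : (μ.restrict φ.source).map (fun h => theta lam X J φ (φ h)) =
      (μ.restrict φ.source).map (projBeta lam X J) := by
    refine Measure.map_congr ?_
    filter_upwards [ae_restrict_mem φ.open_source.measurableSet] with x hx
    exact theta_apply_chart hx
  rw [weight, bigW, this, theta_apply_chart hh]

end Chart

section Representation

variable [MeasurableSpace H] [BorelSpace H]

theorem coeFn_translation [LieGroup 𝓘(ℝ, EH) ∞ H] (μ : Measure H) [μ.IsHaarMeasure] (z : H)
    (F : Lp ℂ 2 μ) : translation (EH := EH) μ z F =ᵐ[μ] fun h => F (z⁻¹ * h) :=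
  Lp.coeFn_compMeasurePreserving F (measurePreserving_left (EH := EH) μ z)

/-- Left invariance of `μ` moves the translation onto the other factor, keeping the window supported
in `𝒪`. -/
theorem inner_translation_left [LieGroup 𝓘(ℝ, EH) ∞ H] (μ : Measure H) [μ.IsHaarMeasure] (z : H)
    (F F' : Lp ℂ 2 μ) :
    inner ℂ (translation (EH := EH) μ z F) F' = ∫ h, inner ℂ (F h) (F' (z * h)) ∂μ := by
  have := topologicalGroup_of_lieGroup 𝓘(ℝ, EH) ∞ (G := H)
  rw [L2.inner_def, ← integral_mul_left_eq_self _ z]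
  refine integral_congr_ae ?_
  have h1 := (measurePreserving_mul_left μ z).quasiMeasurePreserving.ae (coeFn_translation (EH := EH) μ z F)
  filter_upwards [h1] with h hh
  rw [hh]
  simp

theorem inducedRep_mul [FiniteDimensional ℝ EG] [FiniteDimensional ℝ EN]
    [LieGroup 𝓘(ℝ, EG) ∞ G] [LieGroup 𝓘(ℝ, EN) ∞ N] [LieGroup 𝓘(ℝ, EH) ∞ H]
    (hG : IsLieFactorization EG EN EH N H)
    (lam : Module.Dual ℝ (GroupLieAlgebra 𝓘(ℝ, EN) N)) (μ : Measure H) [μ.IsHaarMeasure]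
    (z : H) (x : N) (F : Lp ℂ 2 μ) :
    inducedRep hG lam μ ((z : G) * x) F =
      translation (EH := EH) μ z (modulation hG lam μ (lieLog x) F) := by
  have h : hG.isComplement.symm.equiv ((z : G) * x) = (z, x) := by
    rw [← hG.isComplement.symm.equiv_symm_apply (z, x), Equiv.apply_symm_apply]
  rw [inducedRep, h]

theorem inner_inducedRep [FiniteDimensional ℝ EG] [FiniteDimensional ℝ EN]
    [LieGroup 𝓘(ℝ, EG) ∞ G] [LieGroup 𝓘(ℝ, EN) ∞ N] [LieGroup 𝓘(ℝ, EH) ∞ H]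
    (hG : IsLieFactorization EG EN EH N H)
    (lam : Module.Dual ℝ (GroupLieAlgebra 𝓘(ℝ, EN) N)) (μ : Measure H) [μ.IsHaarMeasure]
    (z : H) (x : N) {f : H → ℂ} (hf : MemLp f 2 μ) (F : Lp ℂ 2 μ) :
    inner ℂ (inducedRep hG lam μ ((z : G) * x) hf.toLp) F =
      ∫ h, inner ℂ (Complex.exp (2 * Real.pi * Complex.I * (beta lam h (lieLog x) : ℝ)) * f h)
        (F (z * h)) ∂μ := by
  rw [inducedRep_mul, inner_translation_left]
  refine integral_congr_ae ?_
  filter_upwards [hf.coeFn_toLp,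
    (memLp_modulation hG lam μ (lieLog x) hf.toLp).coeFn_toLp] with h h1 h2
  rw [modulation, h2, h1]

end Representation

end Setting

end LocalizedFrames

end

/-! ### The density theorem -/

theorem mainTheorem5
    {EG EN EH G : Type*}
    [NormedAddCommGroup EG] [NormedSpace ℝ EG] [FiniteDimensional ℝ EG]
    [NormedAddCommGroup EN] [NormedSpace ℝ EN] [FiniteDimensional ℝ EN]
    [NormedAddCommGroup EH] [NormedSpace ℝ EH] [FiniteDimensional ℝ EH]
    -- the Lie group `G = NH` and its closed Lie subgroups `N` (normal) and `H`
    [TopologicalSpace G] [T2Space G] [SecondCountableTopology G]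
    [ChartedSpace EG G] [Group G] [LieGroup 𝓘(ℝ, EG) ∞ G]
    {N H : Subgroup G} [N.Normal]
    [ChartedSpace EN N] [LieGroup 𝓘(ℝ, EN) ∞ N]
    [ChartedSpace EH H] [LieGroup 𝓘(ℝ, EH) ∞ H] [ConnectedSpace H]
    (hG : LocalizedFrames.IsLieFactorization EG EN EH N H)
    (hN : LocalizedFrames.IsExponentialSolvable EN N)
    -- a left Haar measure on `H`
    [MeasurableSpace H] [BorelSpace H] (μ : Measure H) [μ.IsHaarMeasure]
    -- the linear functional, vanishing on the derived ideal and with `β` an immersion at `1`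
    {n : ℕ} (X : Module.Basis (Fin n) ℝ (GroupLieAlgebra 𝓘(ℝ, EN) N))
    (lam : Module.Dual ℝ (GroupLieAlgebra 𝓘(ℝ, EN) N))
    (hlam : ∀ Y Z : GroupLieAlgebra 𝓘(ℝ, EN) N, lam ⁅Y, Z⁆ = 0)
    (himm : Manifold.IsImmersionAt 𝓘(ℝ, EH) 𝓘(ℝ, Fin n → ℝ) ∞
      (fun (h : H) (k : Fin n) => LocalizedFrames.beta lam h (X k)) 1)
    -- the index set `J` and the chart `(𝒪, φ)`, with `𝒪 = φ.source`
    (J : Finset (Fin n)) (φ : OpenPartialHomeomorph H EH)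
    (hφ : LocalizedFrames.IsAdmissibleChart lam X J φ)
    -- the sets `C` and `Γ_N`
    (C : Set (J → ℝ)) (hC : IsCompact C)
    (hCφ : LocalizedFrames.theta lam X J φ '' φ.target ⊆ C)
    (ΓN : Set N) (hΓdisc : DiscreteTopology ΓN)
    (hΓ : ∀ κ ∈ ΓN, ∃ Y ∈ LocalizedFrames.pSpace X J, LocalizedFrames.lieExp Y = κ)
    (hbasis : LocalizedFrames.IsTrigonometricBasis X J C ΓN)
    -- the window
    (f : H → ℂ) (hf : Continuous f) (hfφ : Function.support f ⊆ φ.source)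
    -- the frame
    (Λ : Set H) (hΛ : DiscreteTopology Λ) (A B : ℝ)
    (hframe : LocalizedFrames.IsFrame
      (fun x : ((((↑) : H → G) '' Λ)⁻¹ * (((↑) : N → G) '' ΓN) : Set G) =>
        LocalizedFrames.inducedRep hG lam μ (x : G)
          ((LocalizedFrames.memLp_window (EH := EH) μ hf hφ.relatively_compact hfφ).toLp f))
      A B) :
    (∀ᵐ h ∂μ,
      Summable (fun ℓ : Λ =>
        ‖f ((ℓ : H) * h) * (Real.sqrt (LocalizedFrames.weight lam X J φ μ ((ℓ : H) * h)) : ℂ)‖ ^ 2) ∧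
      A * (volume.real C)⁻¹ ≤ ∑' ℓ : Λ,
        ‖f ((ℓ : H) * h) * (Real.sqrt (LocalizedFrames.weight lam X J φ μ ((ℓ : H) * h)) : ℂ)‖ ^ 2 ∧
      ∑' ℓ : Λ,
        ‖f ((ℓ : H) * h) * (Real.sqrt (LocalizedFrames.weight lam X J φ μ ((ℓ : H) * h)) : ℂ)‖ ^ 2
          ≤ B * (volume.real C)⁻¹) ∧
    ∃ M : ℝ, ∀ h : H, ‖f h‖ ≤ M := by
  have : IsTopologicalGroup H := topologicalGroup_of_lieGroup 𝓘(ℝ, EH) ∞ (G := H)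
  have : LocallyCompactSpace H := ChartedSpace.locallyCompactSpace EH H
  have : SecondCountableTopology H := TopologicalSpace.Subtype.secondCountableTopology (H : Set G)
  -- A discrete subspace of a second countable space is countable; this permits countably many null
  -- sets and termwise integration.
  have : Countable Λ := TopologicalSpace.separableSpace_iff_countable.mp inferInstance
  have hf2 := LocalizedFrames.memLp_window (EH := EH) μ hf hφ.relatively_compact hfφ
  set T : H → J → ℝ := LocalizedFrames.projBeta lam X J with hT
  have hTc : Continuous T := continuous_pi fun j => LocalizedFrames.continuous_beta hG lam (X j)
  have hTm : Measurable T := hTc.measurable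
  have hinj : Set.InjOn T φ.source := hφ.projBeta_injOn
  have hdiffeo : ∀ x ∈ φ.source, IsLocalDiffeomorphAt 𝓘(ℝ, EH) 𝓘(ℝ, J → ℝ) ∞ T x :=
    fun x hx => hφ.projBeta_isLocalDiffeomorphAt hx
  have hac := LocalizedFrames.map_restrict_absolutelyContinuous μ (volume : Measure (J → ℝ)) hTm
    φ.open_source hinj hdiffeo
  obtain ⟨S, hSm, hS⟩ :=
    LocalizedFrames.exists_measurable_eqOn_invFunOn φ.open_source hinj hdiffeo
  have hST : ∀ h ∈ φ.source, S (T h) = h := fun h hh =>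
    (hS _ ⟨h, hh, rfl⟩).trans (hinj.leftInvOn_invFunOn hh)
  have hTC : T '' φ.source ⊆ C := by
    rwa [hT, LocalizedFrames.projBeta_image_source]
  -- `C` contains the nonempty open set `T '' 𝒪`.
  have hC0 : volume C ≠ 0 := fun h0 =>
    ((LocalizedFrames.isOpen_image_of_isLocalDiffeomorphOn φ.open_source hinj hdiffeo).measure_pos
      volume ⟨_, 1, hφ.one_mem, rfl⟩).ne' (measure_mono_null hTC h0)
  have hC1 : volume C ≠ ⊤ := hC.measure_ne_top
  have hμO : μ φ.source ≠ ⊤ :=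
    ((measure_mono subset_closure).trans_lt hφ.relatively_compact.measure_lt_top).ne
  set w : H → ℝ := fun h => (((μ.restrict φ.source).map T).rnDeriv volume (T h)).toReal with hw
  have hwm : Measurable w := ((Measure.measurable_rnDeriv _ _).comp hTm).ennreal_toReal
  set k : H → ENNReal := fun h => ENNReal.ofReal (‖f h‖ ^ 2 * w h) with hk
  have hkm : Measurable k := ((hf.measurable.norm.pow_const 2).mul hwm).ennreal_ofReal
  -- Off `𝒪` the weight has no meaning, but `f` vanishes there.
  have hkeq : ∀ h, ‖f h * (Real.sqrt (LocalizedFrames.weight lam X J φ μ h) : ℂ)‖ ^ 2 =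
      ‖f h‖ ^ 2 * w h := by
    intro h
    by_cases hh : h ∈ φ.source
    · rw [LocalizedFrames.weight_eq μ hh, norm_mul, mul_pow, Complex.norm_real, Real.norm_eq_abs,
        sq_abs, Real.sq_sqrt ENNReal.toReal_nonneg]
    · simp [Function.notMem_support.mp fun h' => hh (hfφ h')]
  obtain ⟨b, hb⟩ := hbasis
  have hplancherel : ∀ (l : Λ) (g : Lp ℂ 2 μ),
      ∫⁻ h, k ((l : H) * h) * ‖g h‖ₑ ^ 2 ∂μ ≠ ⊤ →
      ∑' κ : ΓN, ‖inner ℂ (LocalizedFrames.inducedRep hG lam μ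
        ((((l : H)⁻¹ : H) : G) * ((κ : N) : G)) hf2.toLp) g‖ₑ ^ 2 =
      volume C * ∫⁻ h, k ((l : H) * h) * ‖g h‖ₑ ^ 2 ∂μ := by
    intro l g hg
    have hshift : ∫⁻ h, k ((l : H) * h) * ‖g h‖ₑ ^ 2 ∂μ =
        ∫⁻ h, k h * ‖g ((l : H)⁻¹ * h)‖ₑ ^ 2 ∂μ := by
      rw [← lintegral_mul_left_eq_self (fun h => k h * ‖g ((l : H)⁻¹ * h)‖ₑ ^ 2) (l : H)]
      simp
    rw [hshift] at hg ⊢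
    refine Eq.trans ?_ (LocalizedFrames.tsum_enorm_integral_sq φ.open_source.measurableSet hμO hTm hSm hST hac
      hC.measurableSet hTC hC0 hC1 _ (fun κ => by fun_prop) b hb hf.measurable hfφ
      ((Lp.stronglyMeasurable g).measurable.comp (measurable_const_mul (l : H)⁻¹)) hg)
    refine tsum_congr fun κ => ?_
    obtain ⟨Y, hY, hYκ⟩ := hΓ κ κ.2
    have hlog : LocalizedFrames.lieLog (E := EN) (κ : N) = Y := by
      rw [← hYκ, LocalizedFrames.lieLog_lieExp hN]
    rw [LocalizedFrames.inner_inducedRep, hlog]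
    simp_rw [LocalizedFrames.beta_eq_sum_of_mem_pSpace lam _ X J hY]
    rfl
  have hbounds := LocalizedFrames.ae_frame_bounds (μ := μ) (K := fun (l : Λ) h => k ((l : H) * h))
    (fun l => hkm.comp (measurable_const_mul (l : H))) (fun _ _ => ENNReal.ofReal_ne_top)
    (ENNReal.ofReal_ne_top (r := B)) hC0 hplancherel
    (fun g => (hframe.tsum_enorm_bounds g).1.trans_eq
      (LocalizedFrames.tsum_inv_mul hG.isComplement Λ ΓN fun x =>
        ‖inner ℂ (LocalizedFrames.inducedRep hG lam μ x hf2.toLp) g‖ₑ ^ 2))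
    (fun g => (LocalizedFrames.tsum_inv_mul hG.isComplement Λ ΓN fun x =>
        ‖inner ℂ (LocalizedFrames.inducedRep hG lam μ x hf2.toLp) g‖ₑ ^ 2).symm.trans_le
      (hframe.tsum_enorm_bounds g).2)
  refine ⟨?_, ?_⟩
  · simp_rw [hkeq]
    have hr : 0 < volume.real C := ENNReal.toReal_pos hC0 hC1
    filter_upwards [hbounds] with h hh
    have hnn : ∀ l : Λ, 0 ≤ ‖f ((l : H) * h)‖ ^ 2 * w ((l : H) * h) := fun l =>
      mul_nonneg (sq_nonneg _) ENNReal.toReal_nonneg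
    -- An infinite sum would contradict the upper bound, since `|C| > 0` and `B` is finite.
    have hsum : Summable fun l : Λ => ‖f ((l : H) * h)‖ ^ 2 * w ((l : H) * h) := by
      refine (ENNReal.summable_toReal (f := fun l : Λ => k ((l : H) * h)) fun htop => ?_).congr
        fun l => ENNReal.toReal_ofReal (hnn l)
      rw [htop, ENNReal.mul_top hC0, top_le_iff] at hh
      exact ENNReal.ofReal_ne_top hh.2
    rw [← ENNReal.ofReal_tsum_of_nonneg hnn hsum, ← ofReal_measureReal hC1,
      ← ENNReal.ofReal_mul hr.le, ENNReal.ofReal_le_ofReal_iff (mul_nonneg hr.le (tsum_nonneg hnn)),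
      ENNReal.ofReal_le_ofReal_iff (hframe.pos.le.trans hframe.le)] at hh
    refine ⟨hsum, ?_, ?_⟩
    · rw [← div_eq_mul_inv, div_le_iff₀' hr]
      exact hh.1
    · rw [← div_eq_mul_inv, le_div_iff₀' hr]
      exact hh.2
  · exact hf.bounded_above_of_compact_support
      (HasCompactSupport.of_support_subset_isCompact hφ.relatively_compact
        (hfφ.trans subset_closure))
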